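/- Consider the periodic Lorentz gas in the plane $\mathbb{R}^2$ whose scatterers are the closed discs of radius $a$ centred at the points of $\mathbb{Z}^2$ (the corners of the unit cells) and the closed discs of radius $b$ centred at the points of $\mathbb{Z}^2+(\tfrac12,\tfrac12)$ (the midpoints of the unit cells), where $0\le b\le a$. A point particle moves with unit speed in the billiard domain, the complement of the open discs, along straight lines between collisions; a tangential contact with a disc counts as a collision. The system has a finite horizon if the lengths of collision-free flights are bounded by a constant depending only on $a$ and $b$. The system is localised if every particle is trapped in a bounded region of the plane, that is, if every connected component of the free region (the complement of the closed discs) is bounded. Then the system has a finite horizon and is not localised if and only if $$\tfrac12-a\le b<\tfrac1{\sqrt2}-a\qquad\text{and}\qquad \tfrac1{2\sqrt2}\le a<\tfrac12 .$$ Under these conditions no particle at all is trapped: every connected component of the free region is unbounded. The lower bound on $a$ cannot be dropped: there are $0<b\le a<\tfrac12$ with $\tfrac12-a\le b<\tfrac1{\sqrt2}-a$ for which the system does not have a finite horizon, so the finite-horizon regime is strictly smaller than the one given by Garrido's condition $\tfrac12-a\le b\le\tfrac1{\sqrt2}-a$. -/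

import Mathlib

/-- The configuration plane of the point particle, with its Euclidean metric. -/
abbrev Plane : Type := EuclideanSpace ℝ (Fin 2)

namespace SquareLorentz

/-- Centres of the discs of the first lattice: the corners of the unit cells. -/
noncomputable def corner (m n : ℤ) : Plane := !₂[(m : ℝ), (n : ℝ)]

/-- Centres of the discs of the second lattice: the midpoints of the unit cells. -/
noncomputable def centre (m n : ℤ) : Plane := !₂[(m : ℝ) + 1 / 2, (n : ℝ) + 1 / 2]

/-- The union of all scatterers: closed discs of radius `a` at the corners of the unit cells and
closed discs of radius `b` at their midpoints. -/
def scatterers (a b : ℝ) : Set Plane :=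
  ⋃ (m : ℤ) (n : ℤ), Metric.closedBall (corner m n) a ∪ Metric.closedBall (centre m n) b

/-- The billiard domain, boundary included: the complement of the open discs. -/
def billiardDomain (a b : ℝ) : Set Plane :=
  {q | ∀ m n : ℤ, a ≤ dist q (corner m n) ∧ b ≤ dist q (centre m n)}

/-- The positions at which the particle touches no scatterer. -/
def freeRegion (a b : ℝ) : Set Plane := (scatterers a b)ᶜ

/-- The free path length from `q` in the direction `v`: the first positive time at which the
particle meets a scatterer (a tangential contact counts as a collision), and `⊤` if it never
does. -/
noncomputable def freePath (a b : ℝ) (q v : Plane) : ENNReal :=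
  ⨅ t ∈ {t : ℝ | 0 < t ∧ q + t • v ∈ scatterers a b}, ENNReal.ofReal t

/-- Finite horizon: the free path lengths of all unit-speed trajectories, started anywhere in
the billiard domain (in particular at a collision), have a common finite upper bound. -/
def FiniteHorizon (a b : ℝ) : Prop :=
  ∃ L : ℝ, ∀ q ∈ billiardDomain a b, ∀ v : Plane, ‖v‖ = 1 → freePath a b q v ≤ ENNReal.ofReal L

/-- The particle at `q` is trapped: the part of the free region that is accessible from `q`,
that is, the connected component of `q`, is bounded. -/
def Trapped (a b : ℝ) (q : Plane) : Prop :=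
  Bornology.IsBounded (connectedComponentIn (freeRegion a b) q)

/-- Localised configuration: every particle is trapped in a bounded region of the plane. -/
def Localised (a b : ℝ) : Prop :=
  ∀ q ∈ freeRegion a b, Trapped a b q

end SquareLorentz

/-!
By periodicity and the symmetries of the square everything reduces to elementary statements about
the predicate `Covered a b x y`, "the point `(x, y)` lies in a scatterer".

*Infinite horizon.* If `a + b < 1/2`, some horizontal line avoids all discs; if
`b ≤ a < 1/(2√2)`, the line `x + y = 1/2` does.

*Finite horizon* (`exists_covered_of_slope_le_one`). Take a line of slope in `[0, 1]`, an integer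
column `m`, and the integer `n` just below the line in that column. If `a + b ≥ 1/2`, a line that
passes between the discs at `(m, n)` and `(m, n + 1)` cannot pass below the disc at
`(m + 1/2, n + 1/2)`; if it also misses that disc it is above it, hence too high to pass below the
disc at `(m + 1, n + 1)`. To pass above that one it would have to climb a vertical distance
`2a √(1 + s²)` in one horizontal unit, where `s` is the slope, and `a ≥ 1/(2√2)`, `s ≤ 1` forbid
that. So one of these four discs is met, which bounds the free path uniformly.

*Localised configurations.* If `a ≥ 1/2`, the lines `x ∈ ℤ` and `y ∈ ℤ` are covered; if
`a + b ≥ 1/√2`, the lines `x ± y ∈ ℤ` are. A component of the free region is then confined to one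
square of the corresponding grid (`localised_of_covered_levels`).

*Escape.* If `a < 1/2` and `a + b < 1/√2`, the free points of the triangle `0 ≤ y ≤ x ≤ 1/2` are
linked to the gap `(1/2, 0)` between two corner discs (`linked_gap_of_triangle`), and a point
between the two discs on the diagonal links this triangle to its mirror image. Hence every free
point is linked to a translate of `(1/2, 0)` by an integer vector, and neighbouring translates are
linked to each other, so every component is unbounded.
-/

namespace SquareLorentz

/-! ### Scatterers in coordinates -/

/-- The point with coordinates `(x, y)` lies in one of the scatterers. Stated with squared
distances, so it agrees with `scatterers` only for nonnegative radii. -/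
def Covered (a b x y : ℝ) : Prop :=
  ∃ m n : ℤ, (x - m) ^ 2 + (y - n) ^ 2 ≤ a ^ 2 ∨
    (x - (m + 1 / 2)) ^ 2 + (y - (n + 1 / 2)) ^ 2 ≤ b ^ 2

lemma dist_le_iff_sq {r : ℝ} (hr : 0 ≤ r) (q : Plane) (x y : ℝ) :
    dist q !₂[x, y] ≤ r ↔ (q 0 - x) ^ 2 + (q 1 - y) ^ 2 ≤ r ^ 2 := by
  rw [EuclideanSpace.dist_eq, Real.sqrt_le_left hr]
  simp [Fin.sum_univ_two, Real.dist_eq, sq_abs]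

lemma mem_scatterers_iff {a b : ℝ} (ha : 0 ≤ a) (hb : 0 ≤ b) (q : Plane) :
    q ∈ scatterers a b ↔ Covered a b (q 0) (q 1) := by
  simp only [scatterers, Set.mem_iUnion, Set.mem_union, Metric.mem_closedBall, corner, centre,
    dist_le_iff_sq ha, dist_le_iff_sq hb, Covered]

lemma mem_freeRegion_iff {a b : ℝ} (ha : 0 ≤ a) (hb : 0 ≤ b) (q : Plane) :
    q ∈ freeRegion a b ↔ ¬ Covered a b (q 0) (q 1) := by
  rw [freeRegion, Set.mem_compl_iff, mem_scatterers_iff ha hb]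

lemma freeRegion_subset_billiardDomain (a b : ℝ) : freeRegion a b ⊆ billiardDomain a b := by
  intro q hq m n
  simp only [freeRegion, scatterers, Set.mem_compl_iff, Set.mem_iUnion, Set.mem_union,
    Metric.mem_closedBall, not_exists, not_or, not_le] at hq
  exact ⟨(hq m n).1.le, (hq m n).2.le⟩

lemma Covered.swap {a b x y : ℝ} : Covered a b x y → Covered a b y x := by
  rintro ⟨m, n, h⟩
  exact ⟨n, m, by rwa [add_comm, add_comm ((y - ((n : ℝ) + 1 / 2)) ^ 2)]⟩

lemma Covered.neg_left {a b x y : ℝ} : Covered a b x y → Covered a b (-x) y := by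
  rintro ⟨m, n, h | h⟩
  · refine ⟨-m, n, Or.inl (le_of_eq_of_le ?_ h)⟩
    push_cast; ring
  · refine ⟨-m - 1, n, Or.inr (le_of_eq_of_le ?_ h)⟩
    push_cast; ring

lemma Covered.neg_right {a b x y : ℝ} (h : Covered a b x y) : Covered a b x (-y) :=
  h.swap.neg_left.swap

lemma Covered.add_int {a b x y : ℝ} (k l : ℤ) :
    Covered a b x y → Covered a b (x + k) (y + l) := by
  rintro ⟨m, n, h⟩
  refine ⟨m + k, n + l, h.imp (le_of_eq_of_le ?_) (le_of_eq_of_le ?_)⟩ <;> (push_cast; ring)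

lemma Covered.of_add_int {a b x y : ℝ} (k l : ℤ) (h : Covered a b (x + k) (y + l)) :
    Covered a b x y := by
  simpa using h.add_int (-k) (-l)

lemma sq_le_sub_intCast_sq {x : ℝ} (h₁ : -(1 / 2) ≤ x) (h₂ : x ≤ 1 / 2) (m : ℤ) :
    x ^ 2 ≤ (x - m) ^ 2 := by
  rcases lt_trichotomy m 0 with hm | rfl | hm
  · have : (m : ℝ) ≤ -1 := by exact_mod_cast Int.le_sub_one_of_lt hm
    nlinarith
  · simp
  · have : (1 : ℝ) ≤ m := by exact_mod_cast hm
    nlinarith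

/-- In the square `[0, 1/2]²` only the discs at `(0, 0)` and `(1/2, 1/2)` matter. -/
lemma not_covered_of_mem_square {a b x y : ℝ} (hx : 0 ≤ x) (hx' : x ≤ 1 / 2) (hy : 0 ≤ y)
    (hy' : y ≤ 1 / 2) (ha : a ^ 2 < x ^ 2 + y ^ 2)
    (hb : b ^ 2 < (x - 1 / 2) ^ 2 + (y - 1 / 2) ^ 2) : ¬ Covered a b x y := by
  rintro ⟨m, n, h | h⟩
  · have := sq_le_sub_intCast_sq (by linarith) hx' m
    have := sq_le_sub_intCast_sq (by linarith) hy' n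
    linarith
  · have h₁ := sq_le_sub_intCast_sq (x := x - 1 / 2) (by linarith) (by linarith) m
    have h₂ := sq_le_sub_intCast_sq (x := y - 1 / 2) (by linarith) (by linarith) n
    rw [sub_sub, add_comm (1 / 2 : ℝ)] at h₁ h₂
    linarith

/-! ### Infinite horizon -/

/-- A line all of whose points are free, with unit direction `(p, r)`, rules out a finite
horizon. -/
lemma not_finiteHorizon_of_line {a b : ℝ} (ha : 0 ≤ a) (hb : 0 ≤ b) {x y p r : ℝ}
    (hpr : p ^ 2 + r ^ 2 = 1) (h : ∀ t : ℝ, ¬ Covered a b (x + t * p) (y + t * r)) :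
    ¬ FiniteHorizon a b := by
  rintro ⟨L, hL⟩
  have hfree : ∀ t : ℝ, (!₂[x, y] + t • !₂[p, r] : Plane) ∉ scatterers a b := fun t => by
    rw [mem_scatterers_iff ha hb]
    simpa using h t
  have hq : (!₂[x, y] : Plane) ∈ billiardDomain a b :=
    freeRegion_subset_billiardDomain a b (by simpa [freeRegion] using hfree 0)
  have hv : ‖(!₂[p, r] : Plane)‖ = 1 := by
    rw [EuclideanSpace.norm_eq]
    simp [Fin.sum_univ_two, hpr]
  have htop : freePath a b !₂[x, y] !₂[p, r] = ⊤ := by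
    simp [freePath, hfree]
  have := hL _ hq _ hv
  rw [htop] at this
  exact absurd this (by simp)

lemma half_le_add_of_finiteHorizon {a b : ℝ} (ha : 0 ≤ a) (hb : 0 ≤ b)
    (h : FiniteHorizon a b) : 1 / 2 ≤ a + b := by
  by_contra! hab
  refine not_finiteHorizon_of_line ha hb (x := 0) (y := (a + (1 / 2 - b)) / 2) (p := 1) (r := 0)
    (by norm_num) (fun t => ?_) h
  rintro ⟨m, n, h | h⟩
  · have := sq_le_sub_intCast_sq (x := (a + (1 / 2 - b)) / 2) (by linarith) (by linarith) n
    rw [mul_zero, add_zero] at h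
    nlinarith [sq_nonneg (0 + t * 1 - (m : ℝ))]
  · have := sq_le_sub_intCast_sq (x := (a + (1 / 2 - b)) / 2 - 1 / 2) (by linarith) (by linarith) n
    rw [mul_zero, add_zero, add_comm (n : ℝ), ← sub_sub _ (1 / 2 : ℝ) (n : ℝ)] at h
    nlinarith [sq_nonneg (0 + t * 1 - ((m : ℝ) + 1 / 2))]

/-- The diagonal corridor: the line `x + y = 1/2` keeps at least the distance `1/(2√2)` from all
centres of both lattices. -/
lemma not_finiteHorizon_of_sq_lt {a b : ℝ} (hb : 0 ≤ b) (hba : b ≤ a)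
    (h : a ^ 2 < 1 / 8) : ¬ FiniteHorizon a b := by
  have h2 : Real.sqrt 2 ^ 2 = 2 := Real.sq_sqrt (by norm_num)
  refine not_finiteHorizon_of_line (hb.trans hba) hb (x := 1 / 2) (y := 0)
    (p := Real.sqrt 2 / 2) (r := -(Real.sqrt 2 / 2)) (by nlinarith) fun t => ?_
  have key : ∀ (u v : ℝ) (k : ℤ), u + v = 1 / 2 - k → 1 / 8 ≤ u ^ 2 + v ^ 2 := by
    intro u v k hk
    have := sq_le_sub_intCast_sq (x := 1 / 2) (by norm_num) le_rfl k
    rw [← hk] at this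
    nlinarith [sq_nonneg (u - v)]
  rw [mul_neg]
  generalize t * (Real.sqrt 2 / 2) = s
  rintro ⟨m, n, h' | h'⟩
  · have := key (1 / 2 + s - m) (0 + -s - n) (m + n) (by push_cast; ring)
    linarith
  · have := key (1 / 2 + s - (m + 1 / 2)) (0 + -s - (n + 1 / 2)) (m + n + 1) (by push_cast; ring)
    have := pow_le_pow_left₀ hb hba 2
    linarith

/-! ### Finite horizon -/

/-- A line through `(x, y)` with unit direction `(p, r)` that passes the point `(X, Y)` at distance
at most `ρ ≤ 1/2`, where `X - x` is between `1` and `3`, comes within distance `ρ` of `(X, Y)` at a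
time in `(0, 7]`: the foot of the perpendicular will do. -/
lemma exists_time_near {x y p r X Y ρ : ℝ} (hpr : p ^ 2 + r ^ 2 = 1) (hp : 1 / 2 ≤ p)
    (hρ : ρ ≤ 1 / 2) (hX : 1 ≤ X - x) (hX' : X - x ≤ 3)
    (hd : -ρ ≤ (Y - y) * p - (X - x) * r) (hd' : (Y - y) * p - (X - x) * r ≤ ρ) :
    ∃ t, 0 < t ∧ t ≤ 7 ∧ (x + t * p - X) ^ 2 + (y + t * r - Y) ^ 2 ≤ ρ ^ 2 := by
  set t := (X - x) * p + (Y - y) * r with ht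
  have hfoot : (x + t * p - X) ^ 2 + (y + t * r - Y) ^ 2 = ((Y - y) * p - (X - x) * r) ^ 2 := by
    have e₁ : x + t * p - X = r * ((Y - y) * p - (X - x) * r) := by
      linear_combination (X - x) * hpr + p * ht
    have e₂ : y + t * r - Y = -p * ((Y - y) * p - (X - x) * r) := by
      linear_combination (Y - y) * hpr + r * ht
    rw [e₁, e₂]
    linear_combination ((Y - y) * p - (X - x) * r) ^ 2 * hpr
  have hsq : (x + t * p - X) ^ 2 + (y + t * r - Y) ^ 2 ≤ ρ ^ 2 := by
    rw [hfoot]; exact sq_le_sq' hd hd'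
  have habs : |x + t * p - X| ≤ 1 / 2 :=
    abs_le_of_sq_le_sq (by nlinarith [sq_nonneg (y + t * r - Y)]) (by norm_num)
  obtain ⟨h₁, h₂⟩ := abs_le.1 habs
  refine ⟨t, ?_, ?_, hsq⟩
  · by_contra! h
    nlinarith
  · by_contra! h
    nlinarith

lemma exists_covered_of_slope_le_one {a b : ℝ} (ha : 0 ≤ a) (hab : 1 / 2 ≤ a + b)
    (ha8 : 1 / 8 ≤ a ^ 2) (ha' : a ≤ 1 / 2) (hb' : b ≤ 1 / 2) (x y : ℝ) {p r : ℝ}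
    (hpr : p ^ 2 + r ^ 2 = 1) (hr : 0 ≤ r) (hrp : r ≤ p) :
    ∃ t, 0 < t ∧ t ≤ 7 ∧ Covered a b (x + t * p) (y + t * r) := by
  have hp : 1 / 2 ≤ p := by nlinarith
  have hp1 : p ≤ 1 := by nlinarith
  have hr2a : r ≤ 2 * a := by nlinarith
  obtain ⟨m, hm₁, hm₂⟩ : ∃ m : ℤ, 1 ≤ (m : ℝ) - x ∧ (m : ℝ) - x ≤ 2 := by
    refine ⟨⌈x⌉ + 1, ?_, ?_⟩ <;> push_cast
    · linarith [Int.le_ceil x]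
    · linarith [Int.ceil_lt_add_one x]
  -- `y + (m - x) * r / p` is the height of the line in the column `m`.
  obtain ⟨n, hn₁, hn₂⟩ : ∃ n : ℤ, (n - y) * p - (m - x) * r ≤ 0 ∧
      0 ≤ (n + 1 - y) * p - (m - x) * r := by
    have hp0 : 0 < p := by linarith
    have e : p * (y + (m - x) * r / p) = p * y + (m - x) * r := by field_simp
    refine ⟨⌊y + (m - x) * r / p⌋, ?_, ?_⟩
    · nlinarith [Int.floor_le (y + (m - x) * r / p)]
    · nlinarith [Int.lt_floor_add_one (y + (m - x) * r / p)]
  by_cases h₁ : -a ≤ (n - y) * p - (m - x) * r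
  · obtain ⟨t, ht, ht', h⟩ := exists_time_near hpr hp ha' hm₁ (by linarith) h₁ (by linarith)
    exact ⟨t, ht, ht', m, n, Or.inl h⟩
  by_cases h₂ : (n + 1 - y) * p - (m - x) * r ≤ a
  · obtain ⟨t, ht, ht', h⟩ := exists_time_near hpr hp ha' hm₁ (by linarith) (by linarith) h₂
    exact ⟨t, ht, ht', m, n + 1, Or.inl (by push_cast; exact h)⟩
  -- The line passes at least `a` above `(m, n)` and rises, so `1/2 ≤ a + b` and `p ≤ 1` keep it from
  -- passing more than `b` below `(m + 1/2, n + 1/2)`.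
  by_cases h₃ : -b ≤ (n + 1 / 2 - y) * p - (m + 1 / 2 - x) * r
  · obtain ⟨t, ht, ht', h⟩ := exists_time_near (ρ := b) (X := m + 1 / 2) (Y := n + 1 / 2) hpr hp hb'
      (by linarith) (by linarith) h₃ (by linarith)
    exact ⟨t, ht, ht', m, n, Or.inr h⟩
  -- In one more unit the line gains at most `r ≤ 2 * a`, too little to clear `(m + 1, n + 1)`.
  · obtain ⟨t, ht, ht', h⟩ := exists_time_near (ρ := a) (x := x) (y := y) (X := m + 1) (Y := n + 1)
      hpr hp ha' (by linarith) (by linarith) (by linarith) (by linarith)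
    exact ⟨t, ht, ht', m + 1, n + 1, Or.inl (by push_cast; exact h)⟩

lemma exists_covered_of_unit {a b : ℝ} (ha : 0 ≤ a) (hab : 1 / 2 ≤ a + b)
    (ha8 : 1 / 8 ≤ a ^ 2) (ha' : a ≤ 1 / 2) (hb' : b ≤ 1 / 2) (x y : ℝ) {p r : ℝ}
    (hpr : p ^ 2 + r ^ 2 = 1) :
    ∃ t, 0 < t ∧ t ≤ 7 ∧ Covered a b (x + t * p) (y + t * r) := by
  have main : ∀ {x y p r : ℝ}, p ^ 2 + r ^ 2 = 1 → 0 ≤ r → 0 ≤ p →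
      ∃ t, 0 < t ∧ t ≤ 7 ∧ Covered a b (x + t * p) (y + t * r) := by
    intro x y p r h hr hp
    rcases le_total r p with hrp | hrp
    · exact exists_covered_of_slope_le_one ha hab ha8 ha' hb' x y h hr hrp
    · obtain ⟨t, ht, ht', hc⟩ := exists_covered_of_slope_le_one ha hab ha8 ha' hb' y x
        (by rwa [add_comm]) hp hrp
      exact ⟨t, ht, ht', hc.swap⟩
  have right : ∀ {x y p r : ℝ}, p ^ 2 + r ^ 2 = 1 → 0 ≤ p →
      ∃ t, 0 < t ∧ t ≤ 7 ∧ Covered a b (x + t * p) (y + t * r) := by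
    intro x y p r h hp
    rcases le_total 0 r with hr | hr
    · exact main h hr hp
    · obtain ⟨t, ht, ht', hc⟩ := main (x := x) (y := -y) (p := p) (r := -r)
        (by rwa [neg_sq]) (by linarith) hp
      exact ⟨t, ht, ht', by convert hc.neg_right using 1; ring⟩
  rcases le_total 0 p with hp | hp
  · exact right hpr hp
  · obtain ⟨t, ht, ht', hc⟩ := right (x := -x) (y := y) (p := -p) (r := r)
      (by rwa [neg_sq]) (by linarith)
    exact ⟨t, ht, ht', by convert hc.neg_left using 1; ring⟩

lemma finiteHorizon_of_le {a b : ℝ} (ha : 0 ≤ a) (hb : 0 ≤ b) (hab : 1 / 2 ≤ a + b)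
    (ha8 : 1 / 8 ≤ a ^ 2) (ha' : a ≤ 1 / 2) (hb' : b ≤ 1 / 2) : FiniteHorizon a b := by
  refine ⟨7, fun q _ v hv => ?_⟩
  have hv' : v 0 ^ 2 + v 1 ^ 2 = 1 := by
    have := EuclideanSpace.real_norm_sq_eq v
    rw [hv, Fin.sum_univ_two] at this
    linarith
  obtain ⟨t, ht, ht', hc⟩ := exists_covered_of_unit ha hab ha8 ha' hb' (q 0) (q 1) hv'
  have hmem : q + t • v ∈ scatterers a b := by
    rw [mem_scatterers_iff ha hb]
    simpa using hc
  exact (iInf₂_le t ⟨ht, hmem⟩).trans (ENNReal.ofReal_le_ofReal ht')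

/-! ### Localised configurations -/

/-- A connected set on which a continuous function omits all integers lies between two consecutive
integer levels. -/
lemma abs_sub_le_one_of_omits_int {s : Set Plane} (hs : IsPreconnected s) {f : Plane → ℝ}
    (hf : Continuous f) (hint : ∀ q ∈ s, ∀ k : ℤ, f q ≠ k) {p q : Plane} (hp : p ∈ s)
    (hq : q ∈ s) : |f p - f q| ≤ 1 := by
  have hoc := (hs.image f hf.continuousOn).ordConnected
  have key : ∀ p ∈ s, ∀ q ∈ s, f p - f q ≤ 1 := by
    intro p hp q hq
    by_contra! h
    obtain ⟨z, hz, hzk⟩ : ((⌊f p⌋ : ℤ) : ℝ) ∈ f '' s :=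
      hoc.out (Set.mem_image_of_mem f hq) (Set.mem_image_of_mem f hp)
        ⟨by linarith [Int.lt_floor_add_one (f p)], Int.floor_le _⟩
    exact hint z hz _ hzk
  rw [abs_le]
  exact ⟨by linarith [key q hq p hp], key p hp q hq⟩

/-- If the integer levels of two continuous functions that control the coordinates are covered, the
configuration is localised. -/
lemma localised_of_covered_levels {a b : ℝ} (ha : 0 ≤ a) (hb : 0 ≤ b) {f g : Plane → ℝ}
    (hf : Continuous f) (hg : Continuous g)
    (hfc : ∀ (q : Plane) (k : ℤ), f q = k → Covered a b (q 0) (q 1))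
    (hgc : ∀ (q : Plane) (k : ℤ), g q = k → Covered a b (q 0) (q 1))
    (hfg : ∀ p q : Plane, dist p q ≤ |f p - f q| + |g p - g q|) : Localised a b := by
  intro q hq
  have hfree : ∀ p ∈ connectedComponentIn (freeRegion a b) q, ¬ Covered a b (p 0) (p 1) :=
    fun p hp => (mem_freeRegion_iff ha hb p).1 (connectedComponentIn_subset _ _ hp)
  have hqc := mem_connectedComponentIn hq
  refine (Metric.isBounded_iff_subset_closedBall q).2 ⟨2, fun p hp => ?_⟩
  rw [Metric.mem_closedBall]
  have h₁ := abs_sub_le_one_of_omits_int isPreconnected_connectedComponentIn hf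
    (fun z hz k hk => hfree z hz (hfc z k hk)) hp hqc
  have h₂ := abs_sub_le_one_of_omits_int isPreconnected_connectedComponentIn hg
    (fun z hz k hk => hfree z hz (hgc z k hk)) hp hqc
  linarith [hfg p q]

lemma dist_eq_sqrt (p q : Plane) :
    dist p q = Real.sqrt ((p 0 - q 0) ^ 2 + (p 1 - q 1) ^ 2) := by
  simp [EuclideanSpace.dist_eq, Fin.sum_univ_two, Real.dist_eq, sq_abs]

lemma covered_of_int_left {a b : ℝ} (ha : 1 / 2 ≤ a) (k : ℤ) (y : ℝ) : Covered a b k y := by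
  refine ⟨k, round y, Or.inl ?_⟩
  rw [sub_self, zero_pow two_ne_zero, zero_add]
  exact sq_le_sq.2 ((abs_sub_round y).trans (ha.trans (le_abs_self a)))

lemma localised_of_half_le {a b : ℝ} (hb : 0 ≤ b) (ha : 1 / 2 ≤ a) : Localised a b := by
  refine localised_of_covered_levels (f := fun q => q 0) (g := fun q => q 1) (by linarith) hb
    (by fun_prop) (by fun_prop) (fun q k hk => ?_) (fun q k hk => ?_) (fun p q => ?_)
  · simp only at hk
    rw [hk]; exact covered_of_int_left ha k _
  · simp only at hk
    rw [hk]; exact (covered_of_int_left ha k _).swap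
  · rw [dist_eq_sqrt]
    refine Real.sqrt_le_iff.2 ⟨by positivity, ?_⟩
    rw [← sq_abs (p 0 - q 0), ← sq_abs (p 1 - q 1)]
    nlinarith [mul_nonneg (abs_nonneg (p 0 - q 0)) (abs_nonneg (p 1 - q 1))]

/-- If neighbouring discs of the two lattices touch, the diagonals of the cells are covered. -/
lemma covered_of_sub_int {a b x y : ℝ} (hab : Real.sqrt 2 / 2 ≤ a + b) (k : ℤ) (h : x - y = k) : Covered a b x y := by
  have h2 : Real.sqrt 2 ^ 2 = 2 := Real.sq_sqrt (by norm_num)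
  have h0 : 0 ≤ Real.sqrt 2 := Real.sqrt_nonneg 2
  -- A point of the segment from `(0, 0)` to `(1/2, 1/2)` is in one of the two discs there.
  have key : ∀ s : ℝ, 0 ≤ s → s ≤ 1 / 2 → 2 * s ^ 2 ≤ a ^ 2 ∨ 2 * (1 / 2 - s) ^ 2 ≤ b ^ 2 := by
    intro s hs hs'
    rcases le_total (Real.sqrt 2 * s) a with h | h
    · left
      calc 2 * s ^ 2 = (Real.sqrt 2 * s) ^ 2 := by rw [mul_pow, h2]
        _ ≤ a ^ 2 := pow_le_pow_left₀ (by positivity) h 2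
    · right
      calc 2 * (1 / 2 - s) ^ 2 = (Real.sqrt 2 * (1 / 2 - s)) ^ 2 := by rw [mul_pow, h2]
        _ ≤ b ^ 2 := pow_le_pow_left₀ (mul_nonneg h0 (by linarith)) (by linarith) 2
  obtain ⟨n, s, hs, hs', rfl⟩ : ∃ (n : ℤ) (s : ℝ), 0 ≤ s ∧ s < 1 ∧ y = n + s :=
    ⟨⌊y⌋, Int.fract y, Int.fract_nonneg y, Int.fract_lt_one y, (Int.floor_add_fract y).symm⟩
  obtain rfl : x = n + s + k := by linarith
  rcases le_total s (1 / 2) with hs2 | hs2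
  · refine ⟨n + k, n, (key s hs hs2).imp (le_of_eq_of_le ?_) (le_of_eq_of_le ?_)⟩ <;>
      (push_cast; ring)
  · rcases key (1 - s) (by linarith) (by linarith) with h' | h'
    · exact ⟨n + k + 1, n + 1, Or.inl (le_of_eq_of_le (by push_cast; ring) h')⟩
    · exact ⟨n + k, n, Or.inr (le_of_eq_of_le (by push_cast; ring) h')⟩

lemma localised_of_le_add {a b : ℝ} (ha : 0 ≤ a) (hb : 0 ≤ b)
    (hab : Real.sqrt 2 / 2 ≤ a + b) : Localised a b := by
  refine localised_of_covered_levels (f := fun q => q 0 - q 1) (g := fun q => q 0 + q 1) ha hb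
    (by fun_prop) (by fun_prop) (fun q k hk => covered_of_sub_int hab k hk)
    (fun q k hk => ?_) (fun p q => ?_)
  · have := (covered_of_sub_int (x := q 0) (y := -q 1) hab k
      (by rw [sub_neg_eq_add]; exact hk)).neg_right
    rwa [neg_neg] at this
  · rw [dist_eq_sqrt]
    refine Real.sqrt_le_iff.2 ⟨by positivity, ?_⟩
    have h₁ := sq_abs (p 0 - p 1 - (q 0 - q 1))
    have h₂ := sq_abs (p 0 + p 1 - (q 0 + q 1))
    nlinarith [mul_nonneg (abs_nonneg (p 0 - p 1 - (q 0 - q 1)))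
      (abs_nonneg (p 0 + p 1 - (q 0 + q 1))), sq_nonneg (p 0 - q 0), sq_nonneg (p 1 - q 1)]

/-! ### Escape -/

/-- The points with coordinates `(x, y)` and `(x', y')` are joined by a path in the free region. -/
def Linked (a b x y x' y' : ℝ) : Prop :=
  JoinedIn (freeRegion a b) !₂[x, y] !₂[x', y']

lemma Linked.symm {a b x y x' y' : ℝ} (h : Linked a b x y x' y') : Linked a b x' y' x y :=
  JoinedIn.symm h

lemma Linked.trans {a b x y x' y' x'' y'' : ℝ} (h : Linked a b x y x' y')
    (h' : Linked a b x' y' x'' y'') : Linked a b x y x'' y'' :=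
  JoinedIn.trans h h'

/-- Links are transported by continuous maps that preserve the free region. -/
lemma Linked.map {a b : ℝ} (ha : 0 ≤ a) (hb : 0 ≤ b) {f g : ℝ → ℝ → ℝ}
    (hf : Continuous fun z : ℝ × ℝ => f z.1 z.2) (hg : Continuous fun z : ℝ × ℝ => g z.1 z.2)
    (hfg : ∀ x y, Covered a b (f x y) (g x y) → Covered a b x y) {x y x' y' : ℝ}
    (h : Linked a b x y x' y') : Linked a b (f x y) (g x y) (f x' y') (g x' y') := by
  have hF : Continuous fun q : Plane => (!₂[f (q 0) (q 1), g (q 0) (q 1)] : Plane) := by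
    have hc : Continuous fun q : Plane => ((q 0, q 1) : ℝ × ℝ) := by fun_prop
    have h₁ := hf.comp hc
    have h₂ := hg.comp hc
    refine (PiLp.continuous_toLp 2 _).comp (continuous_pi fun i => ?_)
    fin_cases i
    · exact h₁
    · exact h₂
  obtain ⟨γ, hγ⟩ := h
  refine ⟨(γ.map hF).cast (by simp) (by simp), fun t => ?_⟩
  have := (mem_freeRegion_iff ha hb _).1 (hγ t)
  rw [mem_freeRegion_iff ha hb]
  exact fun hc => this (hfg _ _ hc)

lemma Linked.swap {a b x y x' y' : ℝ} (ha : 0 ≤ a) (hb : 0 ≤ b) (h : Linked a b x y x' y') :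
    Linked a b y x y' x' :=
  h.map ha hb (f := fun _ y => y) (g := fun x _ => x) (by fun_prop) (by fun_prop)
    fun _ _ hc => hc.swap

lemma Linked.neg_left {a b x y x' y' : ℝ} (ha : 0 ≤ a) (hb : 0 ≤ b)
    (h : Linked a b x y x' y') : Linked a b (-x) y (-x') y' :=
  h.map ha hb (f := fun x _ => -x) (g := fun _ y => y) (by fun_prop) (by fun_prop)
    fun x y hc => by simpa using hc.neg_left

lemma Linked.neg_right {a b x y x' y' : ℝ} (ha : 0 ≤ a) (hb : 0 ≤ b)
    (h : Linked a b x y x' y') : Linked a b x (-y) x' (-y') :=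
  ((h.swap ha hb).neg_left ha hb).swap ha hb

lemma Linked.add_int {a b x y x' y' : ℝ} (ha : 0 ≤ a) (hb : 0 ≤ b)
    (h : Linked a b x y x' y') (k l : ℤ) : Linked a b (x + k) (y + l) (x' + k) (y' + l) :=
  h.map ha hb (f := fun x _ => x + k) (g := fun _ y => y + l) (by fun_prop) (by fun_prop)
    fun _ _ hc => hc.of_add_int k l

lemma linked_of_segment {a b : ℝ} (ha : 0 ≤ a) (hb : 0 ≤ b) {x y x' y' : ℝ}
    (h : ∀ t, 0 ≤ t → t ≤ 1 → ¬ Covered a b (x + t * (x' - x)) (y + t * (y' - y))) :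
    Linked a b x y x' y' := by
  refine JoinedIn.of_segment_subset ?_
  rw [segment_eq_image']
  rintro _ ⟨t, ⟨ht, ht'⟩, rfl⟩
  rw [mem_freeRegion_iff ha hb]
  simpa using h t ht ht'

/-- A free point of the triangle `0 ≤ y ≤ x ≤ 1/2` is linked to the gap `(1/2, 0)`: moving in the
direction `(1, -1)`, away from the diagonal, increases the distance to both discs, and so the point
reaches one of the legs of the triangle, along which it can move to the right angle. -/
lemma linked_gap_of_triangle {a b x y : ℝ} (ha : 0 ≤ a) (hb : 0 ≤ b) (ha' : a < 1 / 2)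
    (hb' : b < 1 / 2) (hy : 0 ≤ y) (hyx : y ≤ x) (hx : x ≤ 1 / 2)
    (hc : a ^ 2 < x ^ 2 + y ^ 2) (hc' : b ^ 2 < (x - 1 / 2) ^ 2 + (y - 1 / 2) ^ 2) :
    Linked a b x y (1 / 2) 0 := by
  have ha2 : a ^ 2 < 1 / 4 := by nlinarith
  have hb2 : b ^ 2 < 1 / 4 := by nlinarith
  have hdiag : ∀ {d : ℝ}, 0 ≤ d → d ≤ y → x + d ≤ 1 / 2 → ¬ Covered a b (x + d) (y - d) := by
    intro d hd hdy hdx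
    have h₁ : 0 ≤ d * (x - y) := mul_nonneg hd (sub_nonneg.2 hyx)
    have h₂ := sq_nonneg d
    have e₁ : (x + d) ^ 2 + (y - d) ^ 2 = x ^ 2 + y ^ 2 + 2 * (d * (x - y)) + 2 * d ^ 2 := by ring
    have e₂ : (x + d - 1 / 2) ^ 2 + (y - d - 1 / 2) ^ 2 =
      (x - 1 / 2) ^ 2 + (y - 1 / 2) ^ 2 + 2 * (d * (x - y)) + 2 * d ^ 2 := by ring
    exact not_covered_of_mem_square (by linarith) hdx (by linarith) (by linarith)
      (by linarith) (by linarith)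
  rcases le_total (x + y) (1 / 2) with h | h
  · refine (linked_of_segment (x' := x + y) (y' := 0) ha hb fun t ht ht' => ?_).trans
      (linked_of_segment ha hb fun t ht ht' => ?_)
    · have hd : 0 ≤ t * y := mul_nonneg ht hy
      have hd' : t * y ≤ y := mul_le_of_le_one_left hy ht'
      have e₁ : x + t * (x + y - x) = x + t * y := by ring
      have e₂ : y + t * (0 - y) = y - t * y := by ring
      rw [e₁, e₂]
      exact hdiag hd (by linarith) (by linarith)
    · have hd : 0 ≤ t * (1 / 2 - (x + y)) := mul_nonneg ht (by linarith)
      have hd' : t * (1 / 2 - (x + y)) ≤ 1 / 2 - (x + y) :=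
        mul_le_of_le_one_left (by linarith) ht'
      have e₂ : (0 : ℝ) + t * (0 - 0) = 0 := by ring
      rw [e₂]
      have hxy : 0 ≤ x + y := add_nonneg (hy.trans hyx) hy
      have hstep : (x + y) ^ 2 ≤ (x + y + t * (1 / 2 - (x + y))) ^ 2 :=
        pow_le_pow_left₀ hxy (by linarith) 2
      refine not_covered_of_mem_square (by linarith) (by linarith) le_rfl (by norm_num) ?_ ?_
      · linarith [mul_nonneg (hy.trans hyx) hy, add_sq x y]
      · linarith [sq_nonneg (x + y + t * (1 / 2 - (x + y)) - 1 / 2)]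
  · refine (linked_of_segment (x' := 1 / 2) (y' := x + y - 1 / 2) ha hb fun t ht ht' => ?_).trans
      (linked_of_segment ha hb fun t ht ht' => ?_)
    · have hd : 0 ≤ t * (1 / 2 - x) := mul_nonneg ht (by linarith)
      have hd' : t * (1 / 2 - x) ≤ 1 / 2 - x := mul_le_of_le_one_left (by linarith) ht'
      have e₂ : y + t * (x + y - 1 / 2 - y) = y - t * (1 / 2 - x) := by ring
      rw [e₂]
      exact hdiag hd (by linarith) (by linarith)
    · have hz : 0 ≤ x + y - 1 / 2 := by linarith
      have hd : 0 ≤ t * (x + y - 1 / 2) := mul_nonneg ht hz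
      have hd' : t * (x + y - 1 / 2) ≤ x + y - 1 / 2 := mul_le_of_le_one_left hz ht'
      have e₁ : (1 / 2 : ℝ) + t * (1 / 2 - 1 / 2) = 1 / 2 := by ring
      have e₂ : x + y - 1 / 2 + t * (0 - (x + y - 1 / 2)) =
        x + y - 1 / 2 - t * (x + y - 1 / 2) := by ring
      rw [e₁, e₂]
      -- The distance of `(1/2, x + y - 1/2)` to the centre of the disc is at least that of `(x, y)`.
      have hstart : (x - 1 / 2) ^ 2 + (y - 1 / 2) ^ 2 ≤ (1 / 2 - (x + y - 1 / 2)) ^ 2 := by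
        nlinarith [mul_nonneg (sub_nonneg.2 hx) (sub_nonneg.2 (hyx.trans hx))]
      have hstep : (1 / 2 - (x + y - 1 / 2)) ^ 2 ≤
          (1 / 2 - (x + y - 1 / 2 - t * (x + y - 1 / 2))) ^ 2 :=
        pow_le_pow_left₀ (by linarith) (by linarith) 2
      refine not_covered_of_mem_square (by norm_num) le_rfl (by linarith) (by linarith) ?_ ?_
      · linarith [sq_nonneg (x + y - 1 / 2 - t * (x + y - 1 / 2))]
      · calc b ^ 2 < _ := hc'.trans_le (hstart.trans hstep)
          _ = _ := by ring

/-- The point of the diagonal halfway between the discs at `(0, 0)` and `(1/2, 1/2)` is linked to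
two different gaps. -/
lemma linked_gap_swap {a b : ℝ} (ha : 0 ≤ a) (hb : 0 ≤ b) (ha' : a < 1 / 2) (hb' : b < 1 / 2)
    (hab : a + b < Real.sqrt 2 / 2) : Linked a b 0 (1 / 2) (1 / 2) 0 := by
  have h2 : Real.sqrt 2 ^ 2 = 2 := Real.sq_sqrt (by norm_num)
  generalize Real.sqrt 2 = w at *
  have hw : 0 < w := by linarith
  set t := (a + (w / 2 - b)) / 2 * (w / 2) with ht
  have ht0 : 0 ≤ t := mul_nonneg (by linarith) (by linarith)
  have ht1 : 1 / 2 - t = (b + (w / 2 - a)) / 2 * (w / 2) := by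
    linear_combination (-1 / 4) * h2 - ht
  have ht2 : t ≤ 1 / 2 := by
    have : 0 ≤ (b + (w / 2 - a)) / 2 * (w / 2) := mul_nonneg (by linarith) (by linarith)
    linarith
  have h₁ : a ^ 2 < t ^ 2 + t ^ 2 := by
    have e : t ^ 2 + t ^ 2 = ((a + (w / 2 - b)) / 2) ^ 2 := by
      rw [ht]; linear_combination ((a + (w / 2 - b)) / 2) ^ 2 / 2 * h2
    rw [e]
    exact pow_lt_pow_left₀ (by linarith) ha two_ne_zero
  have h₂ : b ^ 2 < (t - 1 / 2) ^ 2 + (t - 1 / 2) ^ 2 := by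
    have e : (t - 1 / 2) ^ 2 + (t - 1 / 2) ^ 2 = ((b + (w / 2 - a)) / 2) ^ 2 := by
      rw [← neg_sub, ht1]; linear_combination ((b + (w / 2 - a)) / 2) ^ 2 / 2 * h2
    rw [e]
    exact pow_lt_pow_left₀ (by linarith) hb two_ne_zero
  have h := linked_gap_of_triangle ha hb ha' hb' ht0 le_rfl ht2 h₁ h₂
  exact (h.swap ha hb).symm.trans h

lemma linked_gap_of_abs_le {a b x y : ℝ} (ha : 0 ≤ a) (hb : 0 ≤ b) (ha' : a < 1 / 2)
    (hb' : b < 1 / 2) (hab : a + b < Real.sqrt 2 / 2) (hx : |x| ≤ 1 / 2) (hy : |y| ≤ 1 / 2)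
    (hc : ¬ Covered a b x y) : Linked a b x y (1 / 2) 0 := by
  have hswap := linked_gap_swap ha hb ha' hb' hab
  have square : ∀ {x y : ℝ}, 0 ≤ x → x ≤ 1 / 2 → 0 ≤ y → y ≤ 1 / 2 → ¬ Covered a b x y →
      Linked a b x y (1 / 2) 0 := by
    intro x y hx hx' hy hy' hc
    have h₁ : a ^ 2 < x ^ 2 + y ^ 2 := by
      by_contra! h
      exact hc ⟨0, 0, Or.inl (by simpa using h)⟩
    have h₂ : b ^ 2 < (x - 1 / 2) ^ 2 + (y - 1 / 2) ^ 2 := by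
      by_contra! h
      exact hc ⟨0, 0, Or.inr (by simpa using h)⟩
    rcases le_total y x with hyx | hxy
    · exact linked_gap_of_triangle ha hb ha' hb' hy hyx hx' h₁ h₂
    · have := linked_gap_of_triangle ha hb ha' hb' hx hxy hy' (by linarith) (by linarith)
      exact (this.swap ha hb).trans hswap
  have upper : ∀ {x y : ℝ}, |x| ≤ 1 / 2 → 0 ≤ y → y ≤ 1 / 2 → ¬ Covered a b x y →
      Linked a b x y (1 / 2) 0 := by
    intro x y hx hy hy' hc
    obtain ⟨hx₁, hx₂⟩ := abs_le.1 hx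
    rcases le_total 0 x with h | h
    · exact square h hx₂ hy hy' hc
    · have h₁ := (square (x := -x) (by linarith) (by linarith) hy hy'
        fun h => hc (by simpa using h.neg_left)).neg_left ha hb
      have h₂ := hswap.neg_left ha hb
      rw [neg_neg] at h₁
      rw [neg_zero] at h₂
      exact (h₁.trans h₂.symm).trans hswap
  obtain ⟨hy₁, hy₂⟩ := abs_le.1 hy
  rcases le_total 0 y with h | h
  · exact upper hx h hy₂ hc
  · have := (upper (y := -y) hx (by linarith) (by linarith)
      fun h => hc (by simpa using h.neg_right)).neg_right ha hb
    rwa [neg_neg, neg_zero] at this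

lemma not_covered_gap {a b : ℝ} (ha : 0 ≤ a) (hb : 0 ≤ b) (ha' : a < 1 / 2) (hb' : b < 1 / 2) :
    ¬ Covered a b (1 / 2) 0 := by
  apply not_covered_of_mem_square <;> nlinarith

lemma linked_gap_translate {a b : ℝ} (ha : 0 ≤ a) (hb : 0 ≤ b) (ha' : a < 1 / 2)
    (hb' : b < 1 / 2) (hab : a + b < Real.sqrt 2 / 2) (k : ℕ) :
    Linked a b (1 / 2) 0 (1 / 2 + k) 0 := by
  induction k with
  | zero =>
    simpa using linked_gap_of_abs_le ha hb ha' hb' hab (by norm_num [abs_of_pos]) (by simp)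
      (not_covered_gap ha hb ha' hb')
  | succ k ih =>
    have h₁ : Linked a b (-(1 / 2)) 0 (1 / 2) 0 :=
      linked_gap_of_abs_le ha hb ha' hb' hab (by norm_num [abs_of_pos]) (by simp)
        fun h => not_covered_gap ha hb ha' hb' (by simpa using h.neg_left)
    have h₂ := h₁.add_int ha hb ((k : ℤ) + 1) 0
    have e : -(1 / 2 : ℝ) + (((k : ℤ) + 1 : ℤ) : ℝ) = 1 / 2 + k := by push_cast; ring
    rw [e] at h₂
    refine ih.trans ?_
    simpa using h₂

lemma not_trapped {a b : ℝ} (ha : 0 ≤ a) (hb : 0 ≤ b) (ha' : a < 1 / 2)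
    (hb' : b < 1 / 2) (hab : a + b < Real.sqrt 2 / 2) {q : Plane} (hq : q ∈ freeRegion a b) :
    ¬ Trapped a b q := by
  intro hbd
  set m := round (q 0)
  set n := round (q 1)
  have hlink : Linked a b (q 0) (q 1) (1 / 2 + m) (0 + n) := by
    have hc := (mem_freeRegion_iff ha hb q).1 hq
    have := (linked_gap_of_abs_le (x := q 0 - m) (y := q 1 - n) ha hb ha' hb' hab
      (abs_sub_round _) (abs_sub_round _)
      fun h => hc (by simpa using h.add_int m n)).add_int ha hb m n
    simpa using this
  have hqe : (!₂[q 0, q 1] : Plane) = q := by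
    ext i; fin_cases i <;> rfl
  obtain ⟨R, hR⟩ := (Metric.isBounded_iff_subset_closedBall q).1 hbd
  obtain ⟨k, hk⟩ := exists_nat_gt (R + |1 / 2 + (m : ℝ) - q 0|)
  have hJ : JoinedIn (freeRegion a b) q !₂[1 / 2 + (k : ℝ) + m, 0 + (n : ℝ)] := by
    have := hlink.trans ((linked_gap_translate ha hb ha' hb' hab k).add_int ha hb m n)
    rwa [Linked, hqe] at this
  have hmem : (!₂[1 / 2 + (k : ℝ) + m, 0 + (n : ℝ)] : Plane) ∈
      connectedComponentIn (freeRegion a b) q := by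
    obtain ⟨γ, hγ⟩ := hJ
    exact (isPreconnected_range γ.continuous).subset_connectedComponentIn ⟨0, γ.source⟩
      (Set.range_subset_iff.2 hγ) ⟨1, γ.target⟩
  have hdist := hR hmem
  rw [Metric.mem_closedBall, dist_eq_sqrt] at hdist
  have habs : |1 / 2 + (k : ℝ) + m - q 0| ≤ R := by
    refine le_trans (Real.abs_le_sqrt ?_) hdist
    simp only [Matrix.cons_val_zero, Matrix.cons_val_one]
    exact le_add_of_nonneg_right (sq_nonneg _)
  have := le_abs_self (1 / 2 + (k : ℝ) + m - q 0)
  have := neg_abs_le (1 / 2 + (m : ℝ) - q 0)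
  linarith

lemma one_div_sqrt_two : 1 / Real.sqrt 2 = Real.sqrt 2 / 2 := by
  rw [div_eq_div_iff (by positivity) two_ne_zero, Real.mul_self_sqrt (by norm_num), one_mul]

lemma one_div_two_mul_sqrt_two : 1 / (2 * Real.sqrt 2) = Real.sqrt 2 / 4 := by
  rw [mul_comm, ← div_div, one_div_sqrt_two]
  ring

end SquareLorentz

open SquareLorentz in
theorem mainTheorem6 :
    (∀ a b : ℝ, 0 ≤ b → b ≤ a →
      ((SquareLorentz.FiniteHorizon a b ∧ ¬ SquareLorentz.Localised a b) ↔
        ((1 / 2 - a ≤ b ∧ b < 1 / Real.sqrt 2 - a) ∧ 1 / (2 * Real.sqrt 2) ≤ a ∧ a < 1 / 2))) ∧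
    (∀ a b : ℝ, 1 / 2 - a ≤ b → b < 1 / Real.sqrt 2 - a → 1 / (2 * Real.sqrt 2) ≤ a → a < 1 / 2 →
      ∀ q ∈ SquareLorentz.freeRegion a b, ¬ SquareLorentz.Trapped a b q) ∧
    (∃ a b : ℝ, 0 < b ∧ b ≤ a ∧ a < 1 / 2 ∧ 1 / 2 - a ≤ b ∧ b < 1 / Real.sqrt 2 - a ∧
      ¬ SquareLorentz.FiniteHorizon a b) := by
  rw [one_div_sqrt_two, one_div_two_mul_sqrt_two]
  have h2 : Real.sqrt 2 ^ 2 = 2 := Real.sq_sqrt (by norm_num)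
  have hw : 1.4 < Real.sqrt 2 := Real.lt_sqrt_of_sq_lt (by norm_num)
  have hw' : Real.sqrt 2 < 1.5 := (Real.sqrt_lt' (by norm_num)).2 (by norm_num)
  refine ⟨fun a b hb hba => ⟨fun ⟨hfin, hloc⟩ => ⟨⟨?_, ?_⟩, ?_, ?_⟩,
    fun ⟨⟨h₁, h₂⟩, h₃, h₄⟩ => ⟨?_, fun hloc => ?_⟩⟩, fun a b h₁ h₂ h₃ h₄ q hq => ?_,
    0.35, 0.2, by norm_num, by norm_num, by norm_num, by norm_num, by linarith, ?_⟩
  · linarith [half_le_add_of_finiteHorizon (hb.trans hba) hb hfin]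
  · by_contra! h
    exact hloc (localised_of_le_add (hb.trans hba) hb (by linarith))
  · by_contra! h
    exact not_finiteHorizon_of_sq_lt hb hba (by nlinarith) hfin
  · by_contra! h
    exact hloc (localised_of_half_le hb h)
  · exact finiteHorizon_of_le (hb.trans hba) hb (by linarith) (by nlinarith) h₄.le (by linarith)
  · have ha := hb.trans hba
    have hgap : (!₂[1 / 2, 0] : Plane) ∈ freeRegion a b :=
      (mem_freeRegion_iff ha hb _).2 (by simpa using not_covered_gap ha hb h₄ (by linarith))
    exact not_trapped ha hb h₄ (by linarith) (by linarith) hgap (hloc _ hgap)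
  · exact not_trapped (by linarith) (by linarith) h₄ (by linarith) (by linarith) hq
  · exact not_finiteHorizon_of_sq_lt (by norm_num) (by norm_num) (by norm_num)
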